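/- Let $d \ge 1$ be an integer and let $\alpha > 0$. Let $\mathbb{S} = \{x \in \mathbb{R}^d : \|x\| = 1\}$ be the Euclidean unit sphere of $\mathbb{R}^d$. For $n \ge 1$ and $u_1, \dots, u_n \in \mathbb{S}$ put $$\mathcal{L}_\alpha(u) = \sum_{i=1}^n \log\Bigl(1 + \sum_{\substack{1 \le j \le n\\ j \ne i}} e^{\alpha(\langle u_j, u_i\rangle - 1)}\Bigr).$$ For every $n \ge 1$ let $u^{(n)} = (u^{(n)}_1, \dots, u^{(n)}_n) \in \mathbb{S}^{\times n}$ be a global minimizer of $\mathcal{L}_\alpha$ among all $n$-tuples of points of $\mathbb{S}$, and let $$\mu_n = \frac{1}{n} \sum_{i=1}^n \delta_{u^{(n)}_i}$$ be its empirical measure, a Borel probability measure on $\mathbb{S}$. Then, as $n \to \infty$, $\mu_n$ converges weakly to the uniform probability measure on $\mathbb{S}$, that is, the normalized surface measure. -/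

import Mathlib

open MeasureTheory Filter Topology

noncomputable section

/-- Euclidean space `ℝ^d` with the Euclidean norm and inner product. -/
abbrev Euc (d : ℕ) : Type := EuclideanSpace ℝ (Fin d)

/-- The unit sphere `{x ∈ ℝ^d : ‖x‖ = 1}`, with its subspace topology and Borel sets. -/
abbrev USphere (d : ℕ) : Type := Metric.sphere (0 : Euc d) 1

/-- The loss `L_α(u) = ∑_i log (1 + ∑_{j ≠ i} exp (α (⟨u_j, u_i⟩ - 1)))`. -/
def loss {d n : ℕ} (α : ℝ) (u : Fin n → Euc d) : ℝ :=
  ∑ i, Real.log (1 + ∑ j ∈ Finset.univ.filter (fun j => j ≠ i),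
    Real.exp (α * (inner ℝ (u j) (u i) - 1)))

/-- `u` is a (global) minimizer of `L_α` among all `n`-tuples of points of the unit sphere. -/
def IsLossMinimizer {d n : ℕ} (α : ℝ) (u : Fin n → USphere d) : Prop :=
  ∀ v : Fin n → USphere d,
    loss α (fun i => (u i : Euc d)) ≤ loss α (fun i => (v i : Euc d))

/-- The empirical measure `(1/n) ∑_i δ_{u_i}` of `n ≥ 1` points, as a probability measure. -/
def empiricalMeasure {X : Type*} [MeasurableSpace X] {n : ℕ} [NeZero n] (u : Fin n → X) :
    ProbabilityMeasure X :=
  ⟨(n : ENNReal)⁻¹ • ∑ i, Measure.dirac (u i), ⟨by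
    have hn : (n : ENNReal) ≠ 0 := by exact_mod_cast NeZero.ne n
    simp [ENNReal.inv_mul_cancel hn (ENNReal.natCast_ne_top n)]⟩⟩

/-- The uniform probability measure on the unit sphere of `ℝ^d`, `d ≥ 1`: the surface measure
induced by Lebesgue measure, divided by its total mass. -/
def uniformSphere (d : ℕ) [NeZero d] : ProbabilityMeasure (USphere d) :=
  ⟨((volume : Measure (Euc d)).toSphere Set.univ)⁻¹ • (volume : Measure (Euc d)).toSphere, ⟨by
    have h0 : (volume : Measure (Euc d)).toSphere Set.univ ≠ 0 := by
      rw [Ne, Measure.measure_univ_eq_zero]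
      exact Measure.toSphere_ne_zero _
    rw [Measure.smul_apply, smul_eq_mul]
    exact ENNReal.inv_mul_cancel h0 (measure_ne_top _ _)⟩⟩

end

/-! With `k(x, y) = exp (α (⟨x, y⟩ - 1))` the loss is `∑ log U(u_i)`, where `U(x) = ∑ k(x, u_j)`.
Moving one point of a minimizer to `x` and linearizing the concave logarithm shows that `log U + P`,
with `P` the weighted potential, is at every `u_a` at most its value anywhere plus `ε = O(1/n)`.
Comparing the points of largest and smallest `U` gives `U(u_i) ≤ m e^ε`, and `U ≥ m (1 - ε/2)` on
the whole space (`exists_kernelPotential_bounds`).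

Averaging the second bound over the uniform measure, whose potential is a constant `c`, and the
first over the points gives energy at most `c + o(1)` (`energy_empiricalMeasure_le`). The energy
distance to the uniform measure therefore tends to 0. Expanding the exponential writes it as a
positive combination of squared moment differences (`sq_sub_integral_sphereMonomial_le`), so all
moments converge; polynomials separate points of the compact sphere, whence weak convergence. -/

/-! ### Minimizers for a general kernel bounded below -/

section Kernel

variable {X : Type*} {n : ℕ} {k : X → X → ℝ} {δ : ℝ}

/-- The sum `∑_j k(x, u_j)`. -/
noncomputable def kernelPotential (k : X → X → ℝ) (u : Fin n → X) (x : X) : ℝ := ∑ j, k x (u j)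

/-- The weighted sum `∑_j k(u_j, x) / ∑_i k(u_j, u_i)`. -/
noncomputable def weightedPotential (k : X → X → ℝ) (u : Fin n → X) (x : X) : ℝ :=
  ∑ j, k (u j) x / kernelPotential k u (u j)

lemma mul_le_kernelPotential (hδk : ∀ x y, δ ≤ k x y) (u : Fin n → X) (x : X) :
    n * δ ≤ kernelPotential k u x := by
  have h := Finset.card_nsmul_le_sum Finset.univ (fun j => k x (u j)) δ (fun j _ => hδk _ _)
  simpa [kernelPotential] using h

lemma kernelPotential_le (hk1 : ∀ x y, k x y ≤ 1) (u : Fin n → X) (x : X) :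
    kernelPotential k u x ≤ n := by
  have h := Finset.sum_le_card_nsmul Finset.univ (fun j => k x (u j)) 1 (fun j _ => hk1 _ _)
  simpa [kernelPotential] using h

lemma kernelPotential_update (u : Fin n → X) (a : Fin n) (x y : X) :
    kernelPotential k (Function.update u a x) y
      = kernelPotential k u y - k y (u a) + k y x := by
  unfold kernelPotential
  rw [← Finset.add_sum_erase _ _ (Finset.mem_univ a),
    ← Finset.add_sum_erase (f := fun j => k y (u j)) _ (Finset.mem_univ a)]
  rw [Finset.sum_congr rfl (g := fun j => k y (u j)) (s₂ := Finset.univ.erase a)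
    (fun j hj => by rw [Function.update_of_ne (Finset.ne_of_mem_erase hj)])]
  simp only [Function.update_self]
  ring

/-- The concave logarithm lies below its tangent at `s`, whatever the sign of `t`. -/
lemma Real.log_add_le_log_add_div {s t : ℝ} (hs : 0 < s) (hst : 0 < s + t) :
    Real.log (s + t) ≤ Real.log s + t / s := by
  have h := Real.log_le_sub_one_of_pos (div_pos hst hs)
  rw [Real.log_div hst.ne' hs.ne', add_div, div_self hs.ne'] at h
  linarith

/-- Approximate first-order condition for a minimizer of `∑_i log ∑_j k(u_i, u_j)`, obtained by
moving one point. -/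
lemma log_kernelPotential_add_weightedPotential_le (hδ : 0 < δ) (hδk : ∀ x y, δ ≤ k x y)
    (hdiag : ∀ x, k x x = 1) {u : Fin n → X}
    (hu : ∀ v : Fin n → X, ∑ i, Real.log (kernelPotential k u (u i))
      ≤ ∑ i, Real.log (kernelPotential k v (v i))) (a : Fin n) (x : X) :
    Real.log (kernelPotential k u (u a)) + weightedPotential k u (u a)
      ≤ Real.log (kernelPotential k u x) + weightedPotential k u x + 2 / (n * δ) := by
  have hn : 0 < (n : ℝ) := by exact_mod_cast a.pos
  have hnδ : 0 < n * δ := by positivity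
  have hpos : ∀ (v : Fin n → X) y, 0 < kernelPotential k v y := fun v y =>
    hnδ.trans_le (mul_le_kernelPotential hδk v y)
  have hinv : ∀ {t : ℝ} y, t ≤ 1 → t / kernelPotential k u y ≤ 1 / (n * δ) := by
    intro t y ht
    exact (div_le_div_of_nonneg_right ht (hpos u y).le).trans
      (one_div_le_one_div_of_le hnδ (mul_le_kernelPotential hδk u y))
  have hmin := hu (Function.update u a x)
  rw [← Finset.add_sum_erase _ _ (Finset.mem_univ a),
    ← Finset.add_sum_erase (a := a)
      (f := fun i => Real.log (kernelPotential k (Function.update u a x)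
        (Function.update u a x i))) _ (Finset.mem_univ a)] at hmin
  -- The moved point meets itself with weight 1 instead of `k x (u a)`; this costs one `1 / (n *
  -- δ)`.
  have hself : Real.log (kernelPotential k (Function.update u a x) (Function.update u a x a))
      ≤ Real.log (kernelPotential k u x) + 1 / (n * δ) := by
    rw [Function.update_self]
    have h0 := hpos (Function.update u a x) x
    rw [kernelPotential_update, hdiag, sub_add_eq_add_sub, add_sub_assoc] at h0 ⊢
    have := Real.log_add_le_log_add_div (hpos u x) h0
    have := hinv (t := 1 - k x (u a)) x (by linarith [hδk x (u a)])
    linarith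
  have hrest : ∑ i ∈ Finset.univ.erase a, Real.log (kernelPotential k (Function.update u a x)
        (Function.update u a x i))
      ≤ ∑ i ∈ Finset.univ.erase a, (Real.log (kernelPotential k u (u i))
        + (k (u i) x - k (u i) (u a)) / kernelPotential k u (u i)) := by
    refine Finset.sum_le_sum fun i hi => ?_
    rw [Function.update_of_ne (Finset.ne_of_mem_erase hi)]
    have h0 := hpos (Function.update u a x) (u i)
    rw [kernelPotential_update, sub_add_eq_add_sub, add_sub_assoc] at h0 ⊢
    exact Real.log_add_le_log_add_div (hpos u (u i)) h0
  -- Restoring the missing term `i = a` costs the second `1 / (n * δ)`.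
  have hP : ∑ i ∈ Finset.univ.erase a, (k (u i) x - k (u i) (u a)) / kernelPotential k u (u i)
      ≤ weightedPotential k u x - weightedPotential k u (u a) + 1 / (n * δ) := by
    have h1 : weightedPotential k u x - weightedPotential k u (u a)
        = ∑ i, (k (u i) x - k (u i) (u a)) / kernelPotential k u (u i) := by
      simp only [weightedPotential, sub_div, Finset.sum_sub_distrib]
    rw [h1, ← Finset.add_sum_erase _ _ (Finset.mem_univ a), hdiag]
    have h2 := hinv (t := 1 - k (u a) x) (u a) (by linarith [hδk (u a) x])
    have h3 : (k (u a) x - 1) / kernelPotential k u (u a)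
        = -((1 - k (u a) x) / kernelPotential k u (u a)) := by ring
    linarith
  rw [Finset.sum_add_distrib] at hrest
  have : (2 : ℝ) / (n * δ) = 1 / (n * δ) + 1 / (n * δ) := by ring
  linarith

/-- For a minimizer, the potential is nearly constant on the points and, up to a small error,
nowhere smaller than there. -/
lemma exists_kernelPotential_bounds [NeZero n] (hδ : 0 < δ) (hδk : ∀ x y, δ ≤ k x y)
    (hk1 : ∀ x y, k x y ≤ 1) (hdiag : ∀ x, k x x = 1) (hsymm : ∀ x y, k x y = k y x)
    {u : Fin n → X}
    (hu : ∀ v : Fin n → X, ∑ i, Real.log (kernelPotential k u (u i))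
      ≤ ∑ i, Real.log (kernelPotential k v (v i))) :
    ∃ m : ℝ, 0 < m ∧ m ≤ n ∧
      (∀ i, kernelPotential k u (u i) ≤ m * Real.exp (2 / (n * δ))) ∧
      ∀ x, m * (1 - (2 / (n * δ)) / 2) ≤ kernelPotential k u x := by
  have hn : 0 < (n : ℝ) := by exact_mod_cast Nat.pos_of_ne_zero (NeZero.ne n)
  have hnδ : 0 < n * δ := by positivity
  have hpos : ∀ y, 0 < kernelPotential k u y := fun y =>
    hnδ.trans_le (mul_le_kernelPotential hδk u y)
  obtain ⟨a, ha⟩ := Finite.exists_max fun i => kernelPotential k u (u i)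
  obtain ⟨b, hb⟩ := Finite.exists_min fun i => kernelPotential k u (u i)
  have hfoc := log_kernelPotential_add_weightedPotential_le hδ hδk hdiag hu a
  -- Every denominator is at most the largest one, and the numerators sum to it by symmetry.
  have hPa : 1 ≤ weightedPotential k u (u a) := by
    have h1 : kernelPotential k u (u a) / kernelPotential k u (u a)
        ≤ weightedPotential k u (u a) := by
      nth_rewrite 1 [kernelPotential]
      rw [Finset.sum_div]
      refine Finset.sum_le_sum fun j _ => ?_
      rw [hsymm]
      exact div_le_div_of_nonneg_left (hδ.le.trans (hδk _ _)) (hpos _) (ha j)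
    rwa [div_self (hpos _).ne'] at h1
  have hPx : ∀ x, weightedPotential k u x
      ≤ kernelPotential k u x / kernelPotential k u (u b) := by
    intro x
    nth_rewrite 1 [kernelPotential]
    rw [Finset.sum_div]
    refine Finset.sum_le_sum fun j _ => ?_
    rw [hsymm]
    exact div_le_div_of_nonneg_left (hδ.le.trans (hδk _ _)) (hpos _) (hb j)
  refine ⟨kernelPotential k u (u b), hpos _, kernelPotential_le hk1 u _, fun i => ?_,
    fun x => ?_⟩
  · have h1 := hfoc (u b)
    have h2 := hPx (u b)
    rw [div_self (hpos _).ne'] at h2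
    refine (ha i).trans ?_
    rw [← Real.exp_log (hpos (u a)), ← Real.exp_log (hpos (u b)), ← Real.exp_add]
    exact Real.exp_le_exp.2 (by linarith)
  -- With `m = U(u_b)`, the first-order condition gives `log m + 1 ≤ log U(x) + U(x)/m + ε`, and the
  -- tangent bound `log U(x) ≤ log m + U(x)/m - 1`. Adding them yields `2 - ε ≤ 2 U(x)/m`, hence the
  -- half.
  · have h1 := hfoc x
    have h2 := hPx x
    have h3 := Real.log_le_log (hpos (u b)) (ha b)
    have h4 := Real.log_add_le_log_add_div (s := kernelPotential k u (u b))
      (t := kernelPotential k u x - kernelPotential k u (u b)) (hpos _) (by simpa using hpos x)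
    rw [add_sub_cancel, sub_div, div_self (hpos _).ne'] at h4
    have h5 : 1 - (2 / (n * δ)) / 2 ≤ kernelPotential k u x / kernelPotential k u (u b) := by
      linarith
    rw [le_div_iff₀ (hpos _)] at h5
    linarith

end Kernel

/-! ### Isometry invariance on the sphere and the moment expansion of the energy -/

section Sphere

open Set
open scoped Pointwise

variable {d : ℕ}

/-- The action of a linear isometry on the unit sphere. -/
noncomputable def sphereMap (φ : Euc d ≃ₗᵢ[ℝ] Euc d) (x : USphere d) : USphere d :=
  ⟨φ x, by simp⟩

lemma continuous_sphereMap (φ : Euc d ≃ₗᵢ[ℝ] Euc d) : Continuous (sphereMap φ) :=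
  Continuous.subtype_mk (φ.continuous.comp continuous_subtype_val) _

/-- The surface measure of `s` is a multiple of the volume of the cone over `s`; isometries commute
with forming cones and preserve volume. -/
lemma map_sphereMap_toSphere (φ : Euc d ≃ₗᵢ[ℝ] Euc d) :
    (volume : Measure (Euc d)).toSphere.map (sphereMap φ)
      = (volume : Measure (Euc d)).toSphere := by
  ext s hs
  have hm := (continuous_sphereMap φ).measurable
  rw [Measure.map_apply hm hs, Measure.toSphere_apply' _ (hm hs), Measure.toSphere_apply' _ hs]
  congr 1
  have h : Ioo (0 : ℝ) 1 • ((↑) '' (sphereMap φ ⁻¹' s) : Set (Euc d))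
      = φ ⁻¹' (Ioo (0 : ℝ) 1 • ((↑) '' s)) := by
    ext y
    simp only [Set.mem_smul, Set.mem_image, Set.mem_preimage]
    constructor
    · rintro ⟨r, hr, _, ⟨x, hx, rfl⟩, rfl⟩
      exact ⟨r, hr, _, ⟨sphereMap φ x, hx, rfl⟩, by simp [sphereMap]⟩
    · rintro ⟨r, hr, _, ⟨x, hx, rfl⟩, hy⟩
      refine ⟨r, hr, _, ⟨sphereMap φ.symm x, ?_, rfl⟩, ?_⟩
      · have : sphereMap φ (sphereMap φ.symm x) = x := by
          ext1; simp [sphereMap]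
        rwa [this]
      · apply φ.injective
        rw [← hy]
        simp [sphereMap]
  rw [h]
  exact (φ.measurePreserving).measure_preimage_equiv (f := φ.toMeasurableEquiv) _

lemma integral_comp_sphereMap_uniformSphere [NeZero d] (φ : Euc d ≃ₗᵢ[ℝ] Euc d)
    {f : USphere d → ℝ} (hf : Continuous f) :
    ∫ y, f (sphereMap φ y) ∂(uniformSphere d : Measure (USphere d))
      = ∫ y, f y ∂(uniformSphere d : Measure (USphere d)) := by
  have h : (uniformSphere d : Measure (USphere d)).map (sphereMap φ) = uniformSphere d := by
    change Measure.map _ (_ • _) = _ • _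
    rw [Measure.map_smul, map_sphereMap_toSphere]
  conv_rhs => rw [← h]
  rw [integral_map (continuous_sphereMap φ).aemeasurable hf.aestronglyMeasurable]

/-- Reflection in the hyperplane orthogonal to `x - y` works because the norms agree. -/
lemma exists_sphereMap_eq (x y : USphere d) :
    ∃ φ : Euc d ≃ₗᵢ[ℝ] Euc d, sphereMap φ x = y :=
  ⟨_, Subtype.ext (Submodule.reflection_sub (v := (x : Euc d)) (w := y) (by simp))⟩

/-- The kernel `exp (α (⟨x, y⟩ - 1))` on the sphere. -/
noncomputable def sphereKernel (α : ℝ) (x y : USphere d) : ℝ :=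
  Real.exp (α * (inner ℝ (x : Euc d) (y : Euc d) - 1))

lemma sphereKernel_symm (α : ℝ) (x y : USphere d) :
    sphereKernel α x y = sphereKernel α y x := by
  simp only [sphereKernel, real_inner_comm]

lemma sphereKernel_self (α : ℝ) (x : USphere d) : sphereKernel α x x = 1 := by
  simp [sphereKernel]

lemma abs_inner_sphere_le_one (x y : USphere d) : |inner ℝ (x : Euc d) (y : Euc d)| ≤ 1 := by
  simpa using abs_real_inner_le_norm (x : Euc d) (y : Euc d)

lemma sphereKernel_le_one {α : ℝ} (hα : 0 < α) (x y : USphere d) : sphereKernel α x y ≤ 1 := by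
  rw [sphereKernel, Real.exp_le_one_iff]
  have := (abs_le.1 (abs_inner_sphere_le_one x y)).2
  exact mul_nonpos_of_nonneg_of_nonpos hα.le (by linarith)

lemma exp_le_sphereKernel {α : ℝ} (hα : 0 < α) (x y : USphere d) :
    Real.exp (α * (-2)) ≤ sphereKernel α x y := by
  have := (abs_le.1 (abs_inner_sphere_le_one x y)).1
  exact Real.exp_le_exp.2 (mul_le_mul_of_nonneg_left (by linarith) hα.le)

lemma continuous_sphereKernel (α : ℝ) :
    Continuous fun p : USphere d × USphere d => sphereKernel α p.1 p.2 := by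
  unfold sphereKernel
  fun_prop

lemma sphereKernel_sphereMap (α : ℝ) (φ : Euc d ≃ₗᵢ[ℝ] Euc d) (x y : USphere d) :
    sphereKernel α (sphereMap φ x) (sphereMap φ y) = sphereKernel α x y := by
  simp [sphereKernel, sphereMap]

/-- The potential of the uniform measure is constant on the sphere. -/
lemma integral_sphereKernel_uniformSphere_eq [NeZero d] (α : ℝ) (x y : USphere d) :
    ∫ z, sphereKernel α x z ∂(uniformSphere d : Measure (USphere d))
      = ∫ z, sphereKernel α y z ∂(uniformSphere d : Measure (USphere d)) := by
  obtain ⟨φ, rfl⟩ := exists_sphereMap_eq x y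
  have h := integral_comp_sphereMap_uniformSphere φ (f := sphereKernel α (sphereMap φ x))
    ((continuous_sphereKernel α).comp (Continuous.prodMk_right _))
  simpa only [sphereKernel_sphereMap] using h

/-- The monomial `∏_i x_{f i}` on the sphere. -/
noncomputable def sphereMonomial {k : ℕ} (f : Fin k → Fin d) (x : USphere d) : ℝ := ∏ i, (x : Euc d) (f i)

lemma continuous_sphereMonomial {k : ℕ} (f : Fin k → Fin d) : Continuous (sphereMonomial f) := by
  unfold sphereMonomial
  fun_prop

/-- Indexing by words rather than multi-indices makes every coefficient 1. -/
lemma inner_pow_eq_sum_sphereMonomial (k : ℕ) (x y : USphere d) :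
    inner ℝ (x : Euc d) (y : Euc d) ^ k
      = ∑ f : Fin k → Fin d, sphereMonomial f x * sphereMonomial f y := by
  simp only [sphereMonomial, ← Finset.prod_mul_distrib]
  rw [PiLp.inner_apply, Fintype.sum_pow]
  simp [mul_comm]

lemma hasSum_integral_sphereKernel_prod (α : ℝ) (μ ν : Measure (USphere d))
    [IsProbabilityMeasure μ] [IsProbabilityMeasure ν] :
    HasSum (fun k : ℕ => Real.exp (-α) * (α ^ k / k.factorial *
        ∑ f : Fin k → Fin d, (∫ x, sphereMonomial f x ∂μ) * ∫ y, sphereMonomial f y ∂ν))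
      (∫ p, sphereKernel α p.1 p.2 ∂(μ.prod ν)) := by
  have hc : ∀ k : ℕ, Continuous fun p : USphere d × USphere d =>
      α ^ k / k.factorial * inner ℝ (p.1 : Euc d) (p.2 : Euc d) ^ k := fun k => by fun_prop
  have hint : ∀ {g : USphere d × USphere d → ℝ}, Continuous g → Integrable g (μ.prod ν) :=
    fun hg => hg.integrable_of_hasCompactSupport (HasCompactSupport.of_compactSpace _)
  have hb : ∀ (k : ℕ) (p : USphere d × USphere d),
      ‖α ^ k / k.factorial * inner ℝ (p.1 : Euc d) (p.2 : Euc d) ^ k‖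
        ≤ |α| ^ k / k.factorial := by
    intro k p
    rw [norm_mul, norm_div, norm_pow, norm_pow, Real.norm_eq_abs, Real.norm_eq_abs,
      Real.norm_eq_abs, Nat.abs_cast]
    exact mul_le_of_le_one_right (by positivity)
      (pow_le_one₀ (abs_nonneg _) (abs_inner_sphere_le_one _ _))
  -- Since `|⟨x, y⟩| ≤ 1`, the exponential series of `|α|` dominates.
  have h := hasSum_integral_of_summable_integral_norm (μ := μ.prod ν) (fun k => hint (hc k)) (by
    refine Summable.of_nonneg_of_le (fun k => integral_nonneg fun _ => norm_nonneg _)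
      (fun k => ?_) (Real.summable_pow_div_factorial |α|)
    have := integral_mono (hint (hc k).norm) (integrable_const (μ := μ.prod ν) _) (hb k)
    simpa using this)
  have h' := h.mul_left (Real.exp (-α))
  rw [← integral_const_mul] at h'
  have hterm : ∀ k : ℕ, ∫ p : USphere d × USphere d,
        α ^ k / k.factorial * inner ℝ (p.1 : Euc d) (p.2 : Euc d) ^ k ∂(μ.prod ν)
      = α ^ k / k.factorial *
        ∑ f : Fin k → Fin d, (∫ x, sphereMonomial f x ∂μ) * ∫ y, sphereMonomial f y ∂ν := by
    intro k
    rw [integral_const_mul]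
    simp only [inner_pow_eq_sum_sphereMonomial]
    rw [integral_finsetSum]
    · simp only [integral_prod_mul]
    · intro f _
      exact hint (((continuous_sphereMonomial f).comp continuous_fst).mul
        ((continuous_sphereMonomial f).comp continuous_snd))
  have hexp : ∀ p : USphere d × USphere d, Real.exp (-α) *
        ∑' k : ℕ, α ^ k / k.factorial * inner ℝ (p.1 : Euc d) (p.2 : Euc d) ^ k
      = sphereKernel α p.1 p.2 := by
    intro p
    have := (NormedSpace.expSeries_div_hasSum_exp (𝔸 := ℝ)
      (α * inner ℝ (p.1 : Euc d) (p.2 : Euc d))).tsum_eq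
    simp only [mul_pow, mul_div_right_comm, ← Real.exp_eq_exp_ℝ] at this
    rw [this, sphereKernel, ← Real.exp_add]
    congr 1
    ring
  simpa only [hterm, hexp] using h'

/-- The energy distance associated with `sphereKernel` controls the moments. -/
lemma sq_sub_integral_sphereMonomial_le {α : ℝ} (hα : 0 < α) (μ ν : Measure (USphere d))
    [IsProbabilityMeasure μ] [IsProbabilityMeasure ν] {k : ℕ} (f : Fin k → Fin d) :
    Real.exp (-α) * (α ^ k / k.factorial) *
        (∫ x, sphereMonomial f x ∂μ - ∫ x, sphereMonomial f x ∂ν) ^ 2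
      ≤ ∫ p, sphereKernel α p.1 p.2 ∂(μ.prod μ) - 2 * ∫ p, sphereKernel α p.1 p.2 ∂(μ.prod ν)
        + ∫ p, sphereKernel α p.1 p.2 ∂(ν.prod ν) := by
  have h := ((hasSum_integral_sphereKernel_prod α μ μ).sub
    ((hasSum_integral_sphereKernel_prod α μ ν).mul_left 2)).add
    (hasSum_integral_sphereKernel_prod α ν ν)
  have heq : ∀ l : ℕ, Real.exp (-α) * (α ^ l / l.factorial) * ∑ f : Fin l → Fin d,
        (∫ x, sphereMonomial f x ∂μ - ∫ x, sphereMonomial f x ∂ν) ^ 2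
      = Real.exp (-α) * (α ^ l / l.factorial *
          ∑ f : Fin l → Fin d, (∫ x, sphereMonomial f x ∂μ) * ∫ y, sphereMonomial f y ∂μ)
        - 2 * (Real.exp (-α) * (α ^ l / l.factorial *
          ∑ f : Fin l → Fin d, (∫ x, sphereMonomial f x ∂μ) * ∫ y, sphereMonomial f y ∂ν))
        + Real.exp (-α) * (α ^ l / l.factorial *
          ∑ f : Fin l → Fin d, (∫ x, sphereMonomial f x ∂ν) * ∫ y, sphereMonomial f y ∂ν) := by
    intro l
    have : ∑ f : Fin l → Fin d, (∫ x, sphereMonomial f x ∂μ - ∫ x, sphereMonomial f x ∂ν) ^ 2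
        = (∑ f : Fin l → Fin d, (∫ x, sphereMonomial f x ∂μ) * ∫ y, sphereMonomial f y ∂μ)
          - 2 * (∑ f : Fin l → Fin d,
              (∫ x, sphereMonomial f x ∂μ) * ∫ y, sphereMonomial f y ∂ν)
          + ∑ f : Fin l → Fin d, (∫ x, sphereMonomial f x ∂ν) * ∫ y, sphereMonomial f y ∂ν := by
      rw [Finset.mul_sum, ← Finset.sum_sub_distrib, ← Finset.sum_add_distrib]
      exact Finset.sum_congr rfl fun f _ => by ring
    rw [this]
    ring
  simp only [← heq] at h
  -- All terms are nonnegative, so the single word `f` of length `k` can be kept alone.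
  refine le_trans ?_ (le_hasSum h k fun l _ => ?_)
  · refine mul_le_mul_of_nonneg_left ?_ (by positivity)
    exact Finset.single_le_sum (f := fun f : Fin k → Fin d =>
      (∫ x, sphereMonomial f x ∂μ - ∫ x, sphereMonomial f x ∂ν) ^ 2)
      (fun f _ => sq_nonneg _) (Finset.mem_univ f)
  · exact mul_nonneg (by positivity) (Finset.sum_nonneg fun f _ => sq_nonneg _)

end Sphere

/-! ### From moments and energy to weak convergence -/

section Convergence

variable {d : ℕ}

/-- Convergence of all moments implies weak convergence on the sphere. -/
lemma tendsto_of_tendsto_integral_sphereMonomial {ι : Type*} {l : Filter ι}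
    {μ : ι → ProbabilityMeasure (USphere d)} {ν : ProbabilityMeasure (USphere d)}
    (h : ∀ (k : ℕ) (f : Fin k → Fin d),
      Tendsto (fun i => ∫ x, sphereMonomial f x ∂(μ i : Measure (USphere d))) l
        (𝓝 (∫ x, sphereMonomial f x ∂(ν : Measure (USphere d))))) :
    Tendsto μ l (𝓝 ν) := by
  let coord : Fin d → BoundedContinuousFunction (USphere d) ℝ := fun j =>
    BoundedContinuousFunction.mkOfCompact ⟨fun x => (x : Euc d) j, by fun_prop⟩
  let A : StarSubalgebra ℝ (BoundedContinuousFunction (USphere d) ℝ) :=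
    { Algebra.adjoin ℝ (Set.range coord) with
      star_mem' := fun {a} ha => by
        rwa [show star a = a from BoundedContinuousFunction.ext fun x => star_trivial (a x)] }
  refine ProbabilityMeasure.tendsto_of_tight_of_separatesPoints ℝ
    IsTightMeasureSet.of_compactSpace (A := A) ?_ ?_
  · intro x y hxy
    obtain ⟨j, hj⟩ : ∃ j, (x : Euc d) j ≠ (y : Euc d) j := by
      by_contra! hcon
      exact hxy (Subtype.ext (PiLp.ext hcon))
    have hmem : coord j ∈ A := Algebra.subset_adjoin ⟨j, rfl⟩
    exact ⟨_, ⟨_, StarSubalgebra.mem_map.2 ⟨_, hmem, rfl⟩, rfl⟩, hj⟩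
  · intro g hg
    replace hg : g ∈ Subalgebra.toSubmodule (Algebra.adjoin ℝ (Set.range coord)) := hg
    -- By linearity it suffices to treat products of coordinates.
    rw [Algebra.adjoin_eq_span] at hg
    induction hg using Submodule.span_induction with
    | mem g hg =>
      obtain ⟨k, f, hf⟩ : ∃ (k : ℕ) (f : Fin k → Fin d), ∀ x, g x = sphereMonomial f x := by
        induction hg using Submonoid.closure_induction_left with
        | one => exact ⟨0, Fin.elim0, fun x => by simp [sphereMonomial]⟩
        | mul_left p hp q _ ih =>
          obtain ⟨j, rfl⟩ := hp
          obtain ⟨k, f, hf⟩ := ih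
          refine ⟨k + 1, Fin.cons j f, fun x => ?_⟩
          simp only [BoundedContinuousFunction.mul_apply, hf, sphereMonomial, Fin.prod_univ_succ,
            Fin.cons_zero, Fin.cons_succ]
          rfl
      simpa only [hf] using h k f
    | zero =>
      simp only [BoundedContinuousFunction.coe_zero, Pi.zero_apply, integral_zero]
      exact tendsto_const_nhds
    | add p q _ _ hp hq =>
      simp only [BoundedContinuousFunction.add_apply]
      simp_rw [integral_add (BoundedContinuousFunction.integrable _ p)
        (BoundedContinuousFunction.integrable _ q)]
      exact hp.add hq
    | smul c p _ hp =>
      simp only [BoundedContinuousFunction.smul_apply, integral_smul]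
      exact hp.const_smul c

lemma integral_empiricalMeasure {n : ℕ} [NeZero n] (u : Fin n → USphere d)
    (f : USphere d → ℝ) :
    ∫ x, f x ∂(empiricalMeasure u : Measure (USphere d)) = (n : ℝ)⁻¹ * ∑ i, f (u i) := by
  change ∫ x, f x ∂((n : ENNReal)⁻¹ • ∑ i, Measure.dirac (u i)) = _
  rw [integral_smul_measure, integral_finsetSum_measure fun i _ =>
    integrable_dirac (by simp [enorm_lt_top])]
  simp

/-- The 1 inside the logarithm is the diagonal term `k(u_i, u_i)`. -/
lemma loss_eq_sum_log_kernelPotential {n : ℕ} (α : ℝ) (u : Fin n → USphere d) :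
    loss α (fun i => (u i : Euc d))
      = ∑ i, Real.log (kernelPotential (sphereKernel α) u (u i)) := by
  refine Finset.sum_congr rfl fun i _ => ?_
  congr 1
  rw [kernelPotential, ← Finset.add_sum_erase _ _ (Finset.mem_univ i), sphereKernel_self,
    Finset.filter_ne']
  congr 1
  exact Finset.sum_congr rfl fun j _ => sphereKernel_symm α (u j) (u i)

lemma integral_prod_uniformSphere [NeZero d] (α : ℝ) (μ : Measure (USphere d))
    [IsProbabilityMeasure μ] (x : USphere d) :
    ∫ p, sphereKernel α p.1 p.2 ∂(μ.prod (uniformSphere d : Measure (USphere d)))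
      = ∫ y, sphereKernel α x y ∂(uniformSphere d : Measure (USphere d)) := by
  rw [integral_prod _ ((continuous_sphereKernel α).integrable_of_hasCompactSupport
    (HasCompactSupport.of_compactSpace _))]
  simp only [integral_sphereKernel_uniformSphere_eq α _ x]
  simp

/-- The energy of a loss minimizer is close to that of the uniform measure. -/
lemma energy_empiricalMeasure_le [NeZero d] {n : ℕ} [NeZero n] {α : ℝ} (hα : 0 < α)
    {u : Fin n → USphere d} (hu : IsLossMinimizer α u) (x : USphere d) :
    ∫ p, sphereKernel α p.1 p.2 ∂((empiricalMeasure u : Measure (USphere d)).prod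
        (empiricalMeasure u : Measure (USphere d)))
      ≤ ∫ y, sphereKernel α x y ∂(uniformSphere d : Measure (USphere d))
        + ((2 / (n * Real.exp (α * (-2)))) / 2
          + (Real.exp (2 / (n * Real.exp (α * (-2)))) - 1)) := by
  set ε : ℝ := 2 / (n * Real.exp (α * (-2))) with hε
  set c : ℝ := ∫ y, sphereKernel α x y ∂(uniformSphere d : Measure (USphere d)) with hc
  have hn : 0 < (n : ℝ) := by exact_mod_cast Nat.pos_of_ne_zero (NeZero.ne n)
  have hε0 : 0 ≤ ε := by positivity
  have hcont' : ∀ y, Continuous fun z => sphereKernel (d := d) α z y := fun y =>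
    (continuous_sphereKernel α).comp (Continuous.prodMk_left y)
  have hint : ∀ {μ : Measure (USphere d)} [IsProbabilityMeasure μ] {f : USphere d → ℝ},
      Continuous f → Integrable f μ := fun hf =>
    hf.integrable_of_hasCompactSupport (HasCompactSupport.of_compactSpace _)
  obtain ⟨m, hm0, hmn, hup, hlow⟩ := exists_kernelPotential_bounds (Real.exp_pos (α * (-2)))
    (exp_le_sphereKernel (d := d) hα) (sphereKernel_le_one hα) (sphereKernel_self α)
    (sphereKernel_symm α) (u := u) fun v => by
      simpa only [loss_eq_sum_log_kernelPotential] using hu v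
  rw [← hε] at hup hlow
  have hpc : Continuous (kernelPotential (sphereKernel α) u) :=
    continuous_finsetSum _ fun j _ => hcont' (u j)
  -- Integrate the pointwise lower bound against the uniform measure.
  have hnc : m * (1 - ε / 2) ≤ n * c := by
    have h1 : ∫ y, kernelPotential (sphereKernel α) u y
        ∂(uniformSphere d : Measure (USphere d)) = n * c := by
      unfold kernelPotential
      rw [integral_finsetSum _ fun j _ => hint (hcont' (u j))]
      have h2 : ∀ j, ∫ y, sphereKernel α y (u j) ∂(uniformSphere d : Measure (USphere d)) = c :=
        fun j => by
          simp only [sphereKernel_symm α _ (u j)]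
          exact integral_sphereKernel_uniformSphere_eq α _ _
      simp [h2]
    rw [← h1]
    have := integral_mono (μ := (uniformSphere d : Measure (USphere d)))
      (integrable_const _) (hint hpc) hlow
    simpa using this
  have hE : ∫ p, sphereKernel α p.1 p.2 ∂((empiricalMeasure u : Measure (USphere d)).prod
        (empiricalMeasure u : Measure (USphere d))) ≤ m / n * Real.exp ε := by
    rw [integral_prod _ ((continuous_sphereKernel α).integrable_of_hasCompactSupport
      (HasCompactSupport.of_compactSpace _))]
    simp only [integral_empiricalMeasure u]
    rw [← Finset.mul_sum]
    have h1 := Finset.sum_le_sum fun i (_ : i ∈ Finset.univ) => hup i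
    simp only [Finset.sum_const, Finset.card_univ, Fintype.card_fin, nsmul_eq_mul] at h1
    calc (n : ℝ)⁻¹ * ((n : ℝ)⁻¹ * ∑ i, kernelPotential (sphereKernel α) u (u i))
        ≤ (n : ℝ)⁻¹ * ((n : ℝ)⁻¹ * (n * (m * Real.exp ε))) := by gcongr
      _ = m / n * Real.exp ε := by field_simp
  -- This turns the relative errors in `m / n * exp ε` into absolute ones.
  have hmn' : m / n ≤ 1 := (div_le_one hn).2 hmn
  have hmn0 : 0 ≤ m / n := by positivity
  have hmc : m / n * (1 - ε / 2) ≤ c := by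
    rw [div_mul_eq_mul_div, div_le_iff₀ hn]
    linarith
  have h1 : m / n * (ε / 2) ≤ ε / 2 := mul_le_of_le_one_left (by linarith) hmn'
  have h2 : m / n * (Real.exp ε - 1) ≤ Real.exp ε - 1 :=
    mul_le_of_le_one_left (by linarith [Real.add_one_le_exp ε]) hmn'
  linarith

end Convergence

theorem theorem3 (d : ℕ) [NeZero d] (α : ℝ) (hα : 0 < α)
    (u : ∀ n : ℕ+, Fin n → USphere d) (hu : ∀ n : ℕ+, IsLossMinimizer α (u n)) :
    Tendsto (fun n : ℕ+ => empiricalMeasure (u n)) atTop (𝓝 (uniformSphere d)) := by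
  refine tendsto_of_tendsto_integral_sphereMonomial fun k f => ?_
  have hε : Tendsto (fun n : ℕ+ => (2 : ℝ) / ((n : ℕ) * Real.exp (α * (-2)))) atTop (𝓝 0) :=
    tendsto_const_nhds.div_atTop
      ((tendsto_natCast_atTop_atTop.comp tendsto_PNat_val_atTop_atTop).atTop_mul_const
        (Real.exp_pos _))
  have hbound : ∀ n : ℕ+, Real.exp (-α) * (α ^ k / k.factorial) *
      (∫ x, sphereMonomial f x ∂(empiricalMeasure (u n) : Measure (USphere d))
        - ∫ x, sphereMonomial f x ∂(uniformSphere d : Measure (USphere d))) ^ 2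
      ≤ (2 / ((n : ℕ) * Real.exp (α * (-2)))) / 2
          + (Real.exp (2 / ((n : ℕ) * Real.exp (α * (-2)))) - 1) := by
    intro n
    -- The cross energy and the uniform self-energy both equal `c`, so the energy distance is the
    -- excess of the empirical energy over `c`.
    have h1 := sq_sub_integral_sphereMonomial_le hα
      (empiricalMeasure (u n) : Measure (USphere d)) (uniformSphere d : Measure (USphere d)) f
    have h2 := energy_empiricalMeasure_le hα (hu n) (u n 0)
    rw [integral_prod_uniformSphere α _ (u n 0), integral_prod_uniformSphere α _ (u n 0)] at h1
    linarith
  have hC : 0 < Real.exp (-α) * (α ^ k / k.factorial) := by positivity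
  have hlim : Tendsto (fun n : ℕ+ => ((2 / ((n : ℕ) * Real.exp (α * (-2)))) / 2
      + (Real.exp (2 / ((n : ℕ) * Real.exp (α * (-2)))) - 1))
      / (Real.exp (-α) * (α ^ k / k.factorial))) atTop (𝓝 0) := by
    have := ((hε.div_const 2).add (((Real.continuous_exp.tendsto 0).comp hε).sub_const 1)).div_const
      (Real.exp (-α) * (α ^ k / k.factorial))
    simpa using this
  have hsq := squeeze_zero (fun n => sq_nonneg _)
    (fun n => (le_div_iff₀' hC).2 (hbound n)) hlim
  rw [tendsto_iff_dist_tendsto_zero]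
  have := hsq.sqrt
  simpa [Real.sqrt_sq_eq_abs, Real.dist_eq] using this
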